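/- Consider ordered rooted binary trees, in which every node is either a leaf or has exactly two children, a left one and a right one. The size of a tree is its number of leaves, and $\mathcal{T}_n$ denotes the finite set of trees of size $n$. A tree is a caterpillar if each of its nodes is a leaf or has at least one leaf among its children (in particular the tree with a single leaf is a caterpillar). For a tree $t$, let $\gamma(t)$ be the size of the largest caterpillar among the fringe subtrees of $t$, where a fringe subtree consists of a node of $t$ together with all its descendants. For $n\ge 1$ let $$E_n(\gamma)=\frac{1}{|\mathcal{T}_n|}\sum_{t\in\mathcal{T}_n}\gamma(t)$$ be the expected value of $\gamma$ on a uniformly random tree of $\mathcal{T}_n$. Then $E_n(\gamma)\sim\log_2 n$ as $n\to\infty$, that is, $$\lim_{n\to\infty}\frac{E_n(\gamma)}{\log_2 n}=1.$$ -/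

import Mathlib

/-!
Ordered rooted binary trees are Mathlib's `BinaryTree Unit`: `nil` is the tree consisting of a
single leaf, and `node () l r` is a root with left subtree `l` and right subtree `r`.
The size of a tree is its number of leaves, `BinaryTree.numLeaves`.
-/

namespace CaterpillarTrees

/-- The set `𝒯_n` of ordered rooted binary trees of size `n`, i.e. with exactly `n` leaves
(equivalently, with `n - 1` internal nodes); it is empty for `n = 0`. -/
def treesOfSize : ℕ → Finset (BinaryTree Unit)
  | 0 => ∅
  | n + 1 => BinaryTree.treesOfNumNodesEq n

theorem mem_treesOfSize {n : ℕ} {t : BinaryTree Unit} :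
    t ∈ treesOfSize n ↔ t.numLeaves = n := by
  cases n with
  | zero => simpa [treesOfSize] using t.numLeaves_pos.ne'
  | succ n =>
    rw [treesOfSize, BinaryTree.mem_treesOfNumNodesEq, BinaryTree.numLeaves_eq_numNodes_succ]
    omega

/-- The fringe subtrees of a tree: for every node (leaves included) the subtree consisting of
that node together with all its descendants. -/
def fringeSubtrees : BinaryTree Unit → Finset (BinaryTree Unit)
  | .nil => {.nil}
  | .node a l r => insert (.node a l r) (fringeSubtrees l ∪ fringeSubtrees r)

/-- A caterpillar: every node is a leaf or has at least one leaf among its two children. -/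
def IsCaterpillar : BinaryTree Unit → Prop
  | .nil => True
  | .node _ l r => (l = .nil ∨ r = .nil) ∧ IsCaterpillar l ∧ IsCaterpillar r

instance decidableIsCaterpillar : DecidablePred IsCaterpillar
  | .nil => isTrue trivial
  | .node _ l r =>
    have := decidableIsCaterpillar l
    have := decidableIsCaterpillar r
    inferInstanceAs (Decidable ((l = .nil ∨ r = .nil) ∧ IsCaterpillar l ∧ IsCaterpillar r))

/-- `γ(t)`: the size (number of leaves) of the largest caterpillar fringe subtree of `t`.
The set over which the supremum is taken is never empty: it contains the one-leaf tree. -/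
def gamma (t : BinaryTree Unit) : ℕ :=
  ((fringeSubtrees t).filter IsCaterpillar).sup BinaryTree.numLeaves

/-- `E_n(γ)`: the expected value of `γ(t)` for `t` uniformly distributed on the trees of
size `n` (used for `n ≥ 1`, where there is at least one such tree). -/
noncomputable def expectedGamma (n : ℕ) : ℝ :=
  (∑ t ∈ treesOfSize n, (gamma t : ℝ)) / ((treesOfSize n).card : ℝ)

end CaterpillarTrees

open Finset

namespace CaterpillarTrees

open BinaryTree

/-! The value of `gamma` concentrates near `log₂ n`, up to `O(log log n)`. There are `2 ^ (k - 2)`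
caterpillars of size `k ≥ 2`, so a random tree of size `n` contains about `n / 2 ^ k` of them up to
polynomial factors in `k`.

Upper bound: by the first moment, the proportion of trees with `k ≤ γ` is at most `n * k / 2 ^ k`
(`two_pow_mul_countGammaGe_le`); summing this tail over `k` bounds the mean (`expectedGamma_le`).

Lower bound: forbidding caterpillars of size `k` enlarges the radius of convergence of the
generating function beyond `1 / 4`. At `(1 + 2 ^ (-k)) / 4` the restricted sum is still at most `1 /
2` (`sum_treesGammaLt_le`), so trees with `γ < k` are exponentially rare on the scale `n / 2 ^ k`
(`countGammaLt_le`). Cutoffs within `O(log log n)` of `log₂ n` then pin down the mean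
(`abs_expectedGamma_sub_logb_le`). -/

/-! ### Recursive structure of `gamma` and enumeration of caterpillars -/

theorem isCaterpillar_node {l r : BinaryTree Unit} {a : Unit} :
    IsCaterpillar (.node a l r) ↔ (l = .nil ∨ r = .nil) ∧ IsCaterpillar l ∧ IsCaterpillar r :=
  Iff.rfl

theorem gamma_nil : gamma .nil = 1 := by
  simp [gamma, fringeSubtrees, IsCaterpillar, Finset.filter_singleton]

theorem gamma_node (a : Unit) (l r : BinaryTree Unit) :
    gamma (.node a l r) =
      (if IsCaterpillar (.node a l r) then l.numLeaves + r.numLeaves else 0) ⊔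
        (gamma l ⊔ gamma r) := by
  unfold gamma
  rw [fringeSubtrees, filter_insert, filter_union]
  split_ifs with h
  · rw [sup_insert, sup_union]; rfl
  · rw [sup_union]; simp

theorem gamma_le_numLeaves (t : BinaryTree Unit) : gamma t ≤ t.numLeaves := by
  induction t with
  | nil => simp [gamma_nil, numLeaves]
  | node a l r hl hr =>
    rw [gamma_node, numLeaves]
    split_ifs <;> simp <;> omega

theorem IsCaterpillar.gamma_eq {t : BinaryTree Unit} (h : IsCaterpillar t) :
    gamma t = t.numLeaves := by
  refine le_antisymm (gamma_le_numLeaves t) ?_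
  cases t with
  | nil => simp [gamma_nil, numLeaves]
  | node a l r => rw [gamma_node, if_pos h, numLeaves]; exact le_sup_left

/-- Going down the spine of a caterpillar removes one leaf at a time, so one of size above `k`
contains one of size exactly `k`. Only that size has to be counted or forbidden. -/
theorem le_gamma_node_iff {k : ℕ} (hk : 2 ≤ k) (a : Unit) (l r : BinaryTree Unit) :
    k ≤ gamma (.node a l r) ↔ k ≤ gamma l ∨ k ≤ gamma r ∨
      (IsCaterpillar (.node a l r) ∧ l.numLeaves + r.numLeaves = k) := by
  rw [gamma_node, le_sup_iff, le_sup_iff]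
  constructor
  · rintro (h | h | h)
    · split_ifs at h with hc
      · obtain ⟨h1, h2, h3⟩ := isCaterpillar_node.1 hc
        rw [h2.gamma_eq, h3.gamma_eq]
        by_cases hn : l.numLeaves + r.numLeaves = k
        · exact .inr (.inr ⟨hc, hn⟩)
        · rcases h1 with rfl | rfl
          · right; left; simp only [numLeaves] at h hn; omega
          · left; simp only [numLeaves] at h hn; omega
      · omega
    · exact .inl h
    · exact .inr (.inl h)
  · rintro (h | h | ⟨hc, h⟩)
    · exact .inr (.inl h)
    · exact .inr (.inr h)
    · left; rw [if_pos hc, h]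

/-- The caterpillars with `m` internal nodes. -/
def caterpillars (m : ℕ) : Finset (BinaryTree Unit) :=
  (treesOfNumNodesEq m).filter IsCaterpillar

theorem mem_caterpillars {m : ℕ} {t : BinaryTree Unit} :
    t ∈ caterpillars m ↔ t.numNodes = m ∧ IsCaterpillar t := by
  simp [caterpillars, mem_treesOfNumNodesEq]

theorem numNodes_eq_zero {t : BinaryTree Unit} : t.numNodes = 0 ↔ t = .nil := by
  cases t <;> simp [numNodes]

theorem card_caterpillars_succ (m : ℕ) : #(caterpillars (m + 1)) = 2 ^ m := by
  induction m with
  | zero =>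
    have : caterpillars (0 + 1) = {.node () .nil .nil} := by
      ext t
      rw [mem_caterpillars, mem_singleton]
      cases t with
      | nil => simp [numNodes]
      | node a l r =>
        simp only [numNodes, node.injEq, isCaterpillar_node, ← numNodes_eq_zero]
        constructor
        · rintro ⟨h, -⟩; exact ⟨trivial, by omega, by omega⟩
        · rintro ⟨-, h, h'⟩
          rw [numNodes_eq_zero] at h h'
          subst h h'
          simp [numNodes, IsCaterpillar]
    rw [this]; rfl
  | succ m ih =>
    have : caterpillars (m + 1 + 1) =
        (caterpillars (m + 1)).image (fun t => .node () .nil t) ∪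
          (caterpillars (m + 1)).image (fun t => .node () t .nil) := by
      ext t
      simp only [mem_union, mem_image, mem_caterpillars]
      cases t with
      | nil => simp [numNodes]
      | node a l r =>
        simp only [numNodes, node.injEq, isCaterpillar_node]
        constructor
        · rintro ⟨h, rfl | rfl, hl, hr⟩
          · left; exact ⟨r, ⟨by simpa [numNodes] using h, hr⟩, trivial, rfl, rfl⟩
          · right; exact ⟨l, ⟨by simpa [numNodes] using h, hl⟩, trivial, rfl, rfl⟩
        · rintro (⟨t, ⟨h, ht⟩, -, rfl, rfl⟩ | ⟨t, ⟨h, ht⟩, -, rfl, rfl⟩)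
          · exact ⟨by simp [numNodes, h], .inl rfl, trivial, ht⟩
          · exact ⟨by simp [numNodes, h], .inr rfl, ht, trivial⟩
    rw [this, card_union_of_disjoint, card_image_of_injective, card_image_of_injective, ih]
    · ring
    · intro s t h; simpa using h
    · intro s t h; simpa using h
    · rw [disjoint_left]
      simp only [mem_image, mem_caterpillars, not_exists, not_and]
      rintro t ⟨s, ⟨hs, -⟩, rfl⟩ u ⟨hu, -⟩ h
      simp only [node.injEq, true_and] at h
      rw [h.1] at hu
      simp [numNodes] at hu

theorem sum_treesOfNumNodesEq_succ {M : Type*} [AddCommMonoid M] (f : BinaryTree Unit → M)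
    (n : ℕ) :
    ∑ t ∈ treesOfNumNodesEq (n + 1), f t = ∑ p ∈ antidiagonal n,
      ∑ l ∈ treesOfNumNodesEq p.1, ∑ r ∈ treesOfNumNodesEq p.2, f (.node () l r) := by
  rw [treesOfNumNodesEq_succ, sum_biUnion]
  · refine sum_congr rfl fun p _ => ?_
    rw [sum_map, sum_product]; rfl
  · simp_rw [Set.PairwiseDisjoint, Set.Pairwise, Function.onFun, disjoint_left]
    rintro ⟨i, j⟩ _ ⟨i', j'⟩ _ hne t ht ht'
    simp only [mem_map, mem_product, mem_treesOfNumNodesEq, Prod.exists] at ht ht'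
    obtain ⟨l, r, ⟨hl, hr⟩, rfl⟩ := ht
    obtain ⟨l', r', ⟨hl', hr'⟩, h⟩ := ht'
    simp at h
    apply hne
    rw [← hl, ← hr, ← hl', ← hr', h.1, h.2]

/-! ### First moment bound for large `gamma` -/

/-- The number of trees with `m` internal nodes containing a caterpillar fringe subtree of size
at least `k`. -/
def countGammaGe (k m : ℕ) : ℕ := #{t ∈ treesOfNumNodesEq m | k ≤ gamma t}

theorem countGammaGe_succ_le (s m : ℕ) :
    countGammaGe (s + 2) (m + 1) ≤ (if m = s then 2 ^ s else 0) +
      2 * ∑ p ∈ antidiagonal m, countGammaGe (s + 2) p.1 * catalan p.2 := by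
  have hcat : ∑ t ∈ treesOfNumNodesEq (m + 1),
      (if IsCaterpillar t ∧ t.numLeaves = s + 2 then 1 else 0) = if m = s then 2 ^ s else 0 := by
    split_ifs with h
    · subst h
      rw [← card_caterpillars_succ, ← card_filter, caterpillars]
      congr 1
      refine filter_congr fun t ht => ?_
      rw [mem_treesOfNumNodesEq] at ht
      simp [numLeaves_eq_numNodes_succ, ht]
    · refine sum_eq_zero fun t ht => if_neg ?_
      rw [mem_treesOfNumNodesEq] at ht
      rw [numLeaves_eq_numNodes_succ, ht]
      rintro ⟨-, h'⟩
      omega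
  have hl : ∀ p : ℕ × ℕ, ∑ l ∈ treesOfNumNodesEq p.1, ∑ r ∈ treesOfNumNodesEq p.2,
      (if s + 2 ≤ gamma l then 1 else 0) = countGammaGe (s + 2) p.1 * catalan p.2 := by
    intro p
    rw [countGammaGe, card_filter, sum_mul]
    refine sum_congr rfl fun l _ => ?_
    rw [sum_const, treesOfNumNodesEq_card_eq_catalan, smul_eq_mul, mul_comm]
  have hr : ∀ p : ℕ × ℕ, ∑ l ∈ treesOfNumNodesEq p.1, ∑ r ∈ treesOfNumNodesEq p.2,
      (if s + 2 ≤ gamma r then 1 else 0) = countGammaGe (s + 2) p.2 * catalan p.1 := by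
    intro p
    rw [sum_comm]
    exact hl p.swap
  have hswap : ∑ p ∈ antidiagonal m, countGammaGe (s + 2) p.2 * catalan p.1 =
      ∑ p ∈ antidiagonal m, countGammaGe (s + 2) p.1 * catalan p.2 :=
    Finset.Nat.sum_antidiagonal_swap (f := fun p : ℕ × ℕ => countGammaGe (s + 2) p.1 * catalan p.2)
  calc countGammaGe (s + 2) (m + 1)
      = ∑ p ∈ antidiagonal m, ∑ l ∈ treesOfNumNodesEq p.1, ∑ r ∈ treesOfNumNodesEq p.2,
          if s + 2 ≤ gamma (.node () l r) then 1 else 0 := by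
        rw [countGammaGe, card_filter, sum_treesOfNumNodesEq_succ]
    _ ≤ ∑ p ∈ antidiagonal m, ∑ l ∈ treesOfNumNodesEq p.1, ∑ r ∈ treesOfNumNodesEq p.2,
          ((if IsCaterpillar (.node () l r) ∧ (BinaryTree.node () l r).numLeaves = s + 2
              then 1 else 0) +
            ((if s + 2 ≤ gamma l then 1 else 0) + (if s + 2 ≤ gamma r then 1 else 0))) := by
        refine sum_le_sum fun p _ => sum_le_sum fun l _ => sum_le_sum fun r _ => ?_
        by_cases h : s + 2 ≤ gamma (.node () l r)
        · rw [if_pos h]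
          rcases (le_gamma_node_iff (by omega) () l r).1 h with h | h | h
          · rw [if_pos h]; omega
          · rw [if_pos h]; omega
          · rw [if_pos (by simpa [numLeaves] using h)]; omega
        · rw [if_neg h]; exact Nat.zero_le _
    _ = _ := by
        simp_rw [sum_add_distrib, hl, hr]
        rw [hswap, ← sum_treesOfNumNodesEq_succ (fun t =>
          if IsCaterpillar t ∧ t.numLeaves = s + 2 then 1 else 0), hcat, two_mul]

/-- Central binomials count trees with a marked leaf, which lies to the left or to the right of the
root. -/
theorem centralBinom_succ_eq_sum (m : ℕ) :
    Nat.centralBinom (m + 1) =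
      2 * ∑ p ∈ antidiagonal m, Nat.centralBinom p.1 * catalan p.2 := by
  have hswap : ∑ p ∈ antidiagonal m, Nat.centralBinom p.2 * catalan p.1 =
      ∑ p ∈ antidiagonal m, Nat.centralBinom p.1 * catalan p.2 :=
    Finset.Nat.sum_antidiagonal_swap (f := fun p : ℕ × ℕ => Nat.centralBinom p.1 * catalan p.2)
  rw [two_mul]
  nth_rw 1 [← hswap]
  rw [← sum_add_distrib, ← succ_mul_catalan_eq_centralBinom, catalan_succ', mul_sum]
  refine sum_congr rfl fun p hp => ?_
  rw [HasAntidiagonal.mem_antidiagonal] at hp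
  rw [← succ_mul_catalan_eq_centralBinom, ← succ_mul_catalan_eq_centralBinom, ← hp]
  ring

theorem countGammaGe_eq_zero {k m : ℕ} (h : m + 1 < k) : countGammaGe k m = 0 := by
  rw [countGammaGe, card_eq_zero, filter_eq_empty_iff]
  intro t ht
  rw [mem_treesOfNumNodesEq] at ht
  have := gamma_le_numLeaves t
  rw [numLeaves_eq_numNodes_succ] at this
  omega

/-- The bound counts ways to graft one of the `2 ^ s` caterpillars of size `s + 2` onto a marked
leaf of a tree with `p` internal nodes. -/
theorem countGammaGe_add_le (s p : ℕ) :
    countGammaGe (s + 2) (s + 1 + p) ≤ 2 ^ s * Nat.centralBinom p := by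
  induction p using Nat.strong_induction_on with
  | _ p ih =>
    have hsum : ∀ n, ∑ x ∈ antidiagonal (s + n), countGammaGe (s + 2) x.1 * catalan x.2 =
        ∑ x ∈ range n, countGammaGe (s + 2) (s + 1 + x) * catalan (n - 1 - x) := by
      intro n
      rw [Nat.sum_antidiagonal_eq_sum_range_succ
        (fun i j => countGammaGe (s + 2) i * catalan j),
        show (s + n).succ = s + 1 + n by simp; omega, sum_range_add]
      rw [sum_eq_zero (s := range (s + 1)), zero_add]
      · refine sum_congr rfl fun x hx => ?_
        rw [show s + n - (s + 1 + x) = n - 1 - x by omega]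
      · intro x hx
        rw [mem_range] at hx
        rw [countGammaGe_eq_zero (by omega), zero_mul]
    have h := countGammaGe_succ_le s (s + p)
    rw [show s + p + 1 = s + 1 + p by omega, hsum] at h
    refine h.trans ?_
    cases p with
    | zero => simp
    | succ p =>
      rw [if_neg (by omega), zero_add, centralBinom_succ_eq_sum,
        Nat.sum_antidiagonal_eq_sum_range_succ (fun i j => Nat.centralBinom i * catalan j),
        mul_left_comm]
      refine Nat.mul_le_mul_left 2 ?_
      rw [mul_sum]
      refine sum_le_sum fun x hx => ?_
      rw [mem_range] at hx
      rw [← mul_assoc]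
      gcongr
      · exact ih x hx
      · exact le_of_eq (by congr 1)

theorem four_pow_mul_centralBinom_le (p j : ℕ) :
    4 ^ j * Nat.centralBinom p ≤ (j + 1) * Nat.centralBinom (p + j) := by
  induction j with
  | zero => simp
  | succ j ih =>
    have h := Nat.succ_mul_centralBinom_succ (p + j)
    refine Nat.le_of_mul_le_mul_left (c := p + j + 1) ?_ (by omega)
    calc (p + j + 1) * (4 ^ (j + 1) * Nat.centralBinom p)
        = 4 * (p + j + 1) * (4 ^ j * Nat.centralBinom p) := by ring
      _ ≤ 4 * (p + j + 1) * ((j + 1) * Nat.centralBinom (p + j)) := by gcongr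
      _ = (4 * (p + j + 1) * (j + 1)) * Nat.centralBinom (p + j) := by ring
      _ ≤ ((j + 2) * (2 * (2 * (p + j) + 1))) * Nat.centralBinom (p + j) := by
        refine Nat.mul_le_mul_right _ ?_; nlinarith
      _ = (j + 2) * ((p + j + 1) * Nat.centralBinom (p + j + 1)) := by rw [h]; ring
      _ = _ := by rw [← add_assoc]; ring

/-- First moment bound: the proportion of trees of size `m + 1` with `k ≤ γ` is at most
`(m + 1) * k / 2 ^ k`. -/
theorem two_pow_mul_countGammaGe_le {k : ℕ} (hk : 2 ≤ k) (m : ℕ) :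
    2 ^ k * countGammaGe k m ≤ (m + 1) * k * catalan m := by
  rcases lt_or_ge (m + 1) k with h | h
  · rw [countGammaGe_eq_zero h]; simp
  obtain ⟨s, rfl⟩ := Nat.exists_eq_add_of_le' hk
  obtain ⟨p, rfl⟩ := Nat.exists_eq_add_of_le (show s + 1 ≤ m by omega)
  calc 2 ^ (s + 2) * countGammaGe (s + 2) (s + 1 + p)
      ≤ 2 ^ (s + 2) * (2 ^ s * Nat.centralBinom p) := by gcongr; exact countGammaGe_add_le s p
    _ = 4 ^ (s + 1) * Nat.centralBinom p := by
      rw [show (4 : ℕ) = 2 ^ 2 by rfl, ← pow_mul, ← mul_assoc, ← pow_add]; congr 2; ring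
    _ ≤ (s + 1 + 1) * Nat.centralBinom (p + (s + 1)) := four_pow_mul_centralBinom_le p (s + 1)
    _ = _ := by rw [add_comm p, ← succ_mul_catalan_eq_centralBinom]; ring

/-! ### Generating function of trees with small `gamma` -/

/-- The trees with fewer than `N` internal nodes and without caterpillar fringe subtrees of size
at least `k`. -/
def treesGammaLt (k N : ℕ) : Finset (BinaryTree Unit) :=
  {t ∈ (range N).biUnion treesOfNumNodesEq | gamma t < k}

theorem mem_treesGammaLt {k N : ℕ} {t : BinaryTree Unit} :
    t ∈ treesGammaLt k N ↔ t.numNodes < N ∧ gamma t < k := by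
  simp [treesGammaLt, mem_treesOfNumNodesEq]

/-- Caterpillars of size `s + 2` are excluded although both their subtrees are allowed, which gains
the extra term; `hN` keeps those subtrees within the truncation. -/
theorem sum_treesGammaLt_succ_le (s : ℕ) {N : ℕ} (hN : s + 1 ≤ N) {r : ℝ} (hr : 0 ≤ r) :
    ∑ t ∈ treesGammaLt (s + 2) (N + 1), r ^ t.numLeaves + 2 ^ s * r ^ (s + 2) ≤
      r + (∑ t ∈ treesGammaLt (s + 2) N, r ^ t.numLeaves) ^ 2 := by
  set S := treesGammaLt (s + 2) N with hS
  have hcat : ∑ t ∈ caterpillars (s + 1), r ^ t.numLeaves = 2 ^ s * r ^ (s + 2) := by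
    rw [sum_congr rfl (g := fun _ => r ^ (s + 2)), sum_const, card_caterpillars_succ,
      nsmul_eq_mul]
    · push_cast; rfl
    · intro t ht
      rw [numLeaves_eq_numNodes_succ, (mem_caterpillars.1 ht).1]
  have hdisj : Disjoint (treesGammaLt (s + 2) (N + 1)) (caterpillars (s + 1)) := by
    rw [disjoint_left]
    intro t ht ht'
    obtain ⟨h1, h2⟩ := mem_caterpillars.1 ht'
    have := (mem_treesGammaLt.1 ht).2
    rw [h2.gamma_eq, numLeaves_eq_numNodes_succ] at this
    omega
  have hsub : treesGammaLt (s + 2) (N + 1) ∪ caterpillars (s + 1) ⊆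
      insert .nil ((S ×ˢ S).image fun p => BinaryTree.node () p.1 p.2) := by
    intro t ht
    cases t with
    | nil => exact mem_insert_self _ _
    | node a l r =>
      refine mem_insert_of_mem (mem_image.2 ⟨(l, r), ?_, rfl⟩)
      rw [mem_product, hS, mem_treesGammaLt, mem_treesGammaLt]
      rcases mem_union.1 ht with ht | ht
      · obtain ⟨h1, h2⟩ := mem_treesGammaLt.1 ht
        rw [numNodes] at h1
        rw [← not_le, le_gamma_node_iff (by omega)] at h2
        push Not at h2
        exact ⟨⟨by simp; omega, h2.1⟩, by simp; omega, h2.2.1⟩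
      · have h1 := (mem_caterpillars.1 ht).1
        rw [numNodes] at h1
        have hl := gamma_le_numLeaves l
        have hr := gamma_le_numLeaves r
        rw [numLeaves_eq_numNodes_succ] at hl hr
        exact ⟨⟨by simp; omega, by simp; omega⟩, by simp; omega, by simp; omega⟩
  rw [← hcat, ← sum_union hdisj]
  refine (sum_le_sum_of_subset_of_nonneg hsub fun t _ _ => pow_nonneg hr _).trans ?_
  rw [sum_insert (by simp), sum_image, sq, sum_mul_sum, sum_product]
  · simp [numLeaves, pow_add]
  · rintro ⟨l, r⟩ _ ⟨l', r'⟩ _ h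
    simpa using h

theorem sum_catalan_div_four_pow (M : ℕ) :
    ∑ m ∈ range M, (catalan m : ℝ) / 4 ^ (m + 1) =
      1 / 2 * (1 - (Nat.centralBinom M : ℝ) / 4 ^ M) := by
  induction M with
  | zero => simp
  | succ M ih =>
    have h1 : ((M : ℝ) + 1) * catalan M = Nat.centralBinom M := by
      exact_mod_cast succ_mul_catalan_eq_centralBinom M
    have h2 : ((M : ℝ) + 1) * Nat.centralBinom (M + 1) =
        2 * (2 * M + 1) * Nat.centralBinom M := by
      exact_mod_cast Nat.succ_mul_centralBinom_succ M
    rw [sum_range_succ, ih]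
    have hM : (M : ℝ) + 1 ≠ 0 := by positivity
    have h3 : (Nat.centralBinom (M + 1) : ℝ) = 2 * (2 * M + 1) * catalan M := by
      apply mul_left_cancel₀ hM
      rw [h2, ← h1]; ring
    rw [h3, ← h1, pow_succ]
    field_simp
    ring

theorem one_add_pow_mul_le_one {M : ℕ} {δ : ℝ} (h0 : 0 ≤ δ) (h1 : δ ≤ 1) :
    (1 + δ) ^ M * (1 - M * δ) ≤ 1 := by
  have h := one_add_mul_le_pow (a := -δ) (by linarith) M
  calc (1 + δ) ^ M * (1 - M * δ) ≤ (1 + δ) ^ M * (1 + -δ) ^ M := by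
        gcongr; linarith
    _ = (1 - δ ^ 2) ^ M := by rw [← mul_pow]; ring
    _ ≤ 1 := pow_le_one₀ (by nlinarith) (by nlinarith)

theorem sq_le_two_pow {M : ℕ} (hM : 4 ≤ M) : M ^ 2 ≤ 2 ^ M := by
  induction M, hM using Nat.le_induction with
  | base => norm_num
  | succ n hn ih => rw [pow_succ 2 n]; nlinarith

/-- The Catalan series at `1 / 4` truncated at `M` misses its limit `1 / 2` by a relative amount of
at least `1 / (2 * M)`, which outweighs the factor `(1 + δ) ^ M`. -/
theorem sum_treesGammaLt_base {M : ℕ} (hM : 4 ≤ M) :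
    ∑ t ∈ treesGammaLt (M + 1) M, ((1 + 1 / 2 ^ (M + 1) : ℝ) / 4) ^ t.numLeaves ≤ 1 / 2 := by
  set δ : ℝ := 1 / 2 ^ (M + 1) with hδ
  have hδ0 : 0 ≤ δ := by positivity
  have hM0 : (0 : ℝ) < M := by exact_mod_cast (by omega : 0 < M)
  have hδ1 : M * δ ≤ 1 / (2 * M) := by
    have : ((M : ℝ)) ^ 2 ≤ 2 ^ M := by exact_mod_cast sq_le_two_pow hM
    rw [hδ, mul_one_div, div_le_div_iff₀ (by positivity) (by positivity), pow_succ]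
    nlinarith
  have hδ2 : δ ≤ 1 := by
    rw [hδ, div_le_one (by positivity)]; exact one_le_pow₀ (by norm_num)
  calc ∑ t ∈ treesGammaLt (M + 1) M, ((1 + δ) / 4) ^ t.numLeaves
      ≤ ∑ t ∈ (range M).biUnion treesOfNumNodesEq, ((1 + δ) / 4) ^ t.numLeaves :=
        sum_le_sum_of_subset_of_nonneg (filter_subset _ _) fun t _ _ => by positivity
    _ = ∑ m ∈ range M, ∑ t ∈ treesOfNumNodesEq m, ((1 + δ) / 4) ^ t.numLeaves := by
        refine sum_biUnion fun i _ j _ hij => disjoint_left.2 fun t h h' => hij ?_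
        rw [mem_treesOfNumNodesEq] at h h'
        rw [← h, ← h']
    _ ≤ ∑ m ∈ range M, (1 + δ) ^ M * ((catalan m : ℝ) / 4 ^ (m + 1)) := by
        refine sum_le_sum fun m hm => ?_
        rw [sum_congr rfl (g := fun _ => ((1 + δ) / 4) ^ (m + 1)), sum_const,
          treesOfNumNodesEq_card_eq_catalan, nsmul_eq_mul, div_pow, ← mul_div_assoc,
          ← mul_div_assoc, mul_comm]
        · gcongr
          · linarith
          · exact mem_range.1 hm
        · intro t ht
          rw [mem_treesOfNumNodesEq] at ht
          rw [numLeaves_eq_numNodes_succ, ht]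
    _ = 1 / 2 * ((1 + δ) ^ M * (1 - (Nat.centralBinom M : ℝ) / 4 ^ M)) := by
        rw [← mul_sum, sum_catalan_div_four_pow]; ring
    _ ≤ 1 / 2 * ((1 + δ) ^ M * (1 - M * δ)) := by
        have h : (4 : ℝ) ^ M ≤ 2 * M * Nat.centralBinom M := by
          exact_mod_cast Nat.four_pow_le_two_mul_self_mul_centralBinom M (by omega)
        gcongr
        refine hδ1.trans ?_
        rw [div_le_div_iff₀ (by positivity) (by positivity)]
        linarith
    _ ≤ 1 / 2 * 1 := by gcongr; exact one_add_pow_mul_le_one hδ0 hδ2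
    _ = 1 / 2 := by norm_num

/-- With `δ = 2 ^ (-(M + 1))`, the excess `δ / 4` of `r` over `1 / 4` is cancelled by the excluded
caterpillars, so `1 / 2` is preserved: `1 / 4 + (1 / 2) ^ 2 = 1 / 2`. -/
theorem sum_treesGammaLt_le {M N : ℕ} (hM : 4 ≤ M) (hN : M ≤ N) :
    ∑ t ∈ treesGammaLt (M + 1) N, ((1 + 1 / 2 ^ (M + 1) : ℝ) / 4) ^ t.numLeaves ≤ 1 / 2 := by
  induction N, hN using Nat.le_induction with
  | base => exact sum_treesGammaLt_base hM
  | succ N hN ih =>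
    obtain ⟨s, rfl⟩ := Nat.exists_eq_add_of_le' (show 1 ≤ M by omega)
    set r : ℝ := (1 + 1 / 2 ^ (s + 1 + 1) : ℝ) / 4 with hr
    have h := sum_treesGammaLt_succ_le s hN (r := r) (by positivity)
    have h1 : 1 / (4 * 2 ^ (s + 2)) ≤ 2 ^ s * r ^ (s + 2) := by
      calc (1 : ℝ) / (4 * 2 ^ (s + 2)) = 2 ^ s * (1 / 4) ^ (s + 2) := by
            rw [show (1 / 4 : ℝ) = 1 / 2 * (1 / 2) by norm_num, mul_pow, one_div_pow]
            field_simp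
            ring
        _ ≤ 2 ^ s * r ^ (s + 2) := by
            gcongr
            rw [hr]; gcongr
            have : (0 : ℝ) ≤ 1 / 2 ^ (s + 1 + 1) := by positivity
            linarith
    have h2 : r = 1 / 4 + 1 / (4 * 2 ^ (s + 2)) := by rw [hr]; field_simp
    have h3 : (∑ t ∈ treesGammaLt (s + 2) N, r ^ t.numLeaves) ^ 2 ≤ (1 / 2) ^ 2 :=
      pow_le_pow_left₀ (sum_nonneg fun t _ => by positivity) ih 2
    change ∑ t ∈ treesGammaLt (s + 2) (N + 1), r ^ t.numLeaves ≤ 1 / 2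
    linarith

/-- The number of trees with `m` internal nodes and without caterpillar fringe subtrees of size
at least `k`. -/
def countGammaLt (k m : ℕ) : ℕ := #{t ∈ treesOfNumNodesEq m | gamma t < k}

theorem countGammaLt_le {k : ℕ} (hk : 5 ≤ k) (m : ℕ) :
    countGammaLt k m * (1 + 1 / 2 ^ k : ℝ) ^ (m + 1) ≤ 4 * (m + 1) ^ 2 * catalan m := by
  obtain ⟨M, rfl⟩ := Nat.exists_eq_add_of_le' (show 1 ≤ k by omega)
  set a : ℝ := 1 + 1 / 2 ^ (M + 1) with ha
  have ha0 : 0 < a := by positivity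
  have h1 : countGammaLt (M + 1) m * (a / 4) ^ (m + 1) ≤ 1 / 2 := by
    -- Here `M` meets the hypothesis on the truncation and `m + 1` makes it contain all trees with
    -- `m` internal nodes.
    refine le_trans ?_ (sum_treesGammaLt_le (M := M) (N := max M (m + 1)) (by omega)
      (le_max_left _ _))
    calc countGammaLt (M + 1) m * (a / 4) ^ (m + 1)
        = ∑ t ∈ treesOfNumNodesEq m with gamma t < M + 1, (a / 4) ^ t.numLeaves := by
          rw [sum_congr rfl (g := fun _ => (a / 4) ^ (m + 1)), sum_const, nsmul_eq_mul,
            countGammaLt]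
          intro t ht
          rw [mem_filter, mem_treesOfNumNodesEq] at ht
          rw [numLeaves_eq_numNodes_succ, ht.1]
      _ ≤ _ := by
          refine sum_le_sum_of_subset_of_nonneg ?_ fun t _ _ => by positivity
          intro t ht
          rw [mem_filter, mem_treesOfNumNodesEq] at ht
          exact mem_treesGammaLt.2 ⟨lt_max_of_lt_right (by omega), ht.2⟩
  have h2 : (4 : ℝ) ^ m ≤ 2 * (m + 1) ^ 2 * catalan m := by
    rcases Nat.eq_zero_or_pos m with rfl | hm
    · simp
    · have h : (4 : ℝ) ^ m ≤ 2 * m * Nat.centralBinom m := by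
        exact_mod_cast Nat.four_pow_le_two_mul_self_mul_centralBinom m hm
      have h' : ((m : ℝ) + 1) * catalan m = Nat.centralBinom m := by
        exact_mod_cast succ_mul_catalan_eq_centralBinom m
      have : (0 : ℝ) ≤ Nat.centralBinom m := Nat.cast_nonneg _
      calc (4 : ℝ) ^ m ≤ 2 * m * Nat.centralBinom m := h
        _ ≤ 2 * (m + 1) * Nat.centralBinom m := by gcongr; linarith
        _ = _ := by rw [← h']; ring
  rw [div_pow, ← mul_div_assoc, div_le_iff₀ (by positivity), pow_succ 4] at h1
  linarith

/-! ### Bounds on the mean and the asymptotics -/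

open Asymptotics Filter

theorem catalan_pos (m : ℕ) : 0 < catalan m := by
  refine pos_of_mul_pos_right (a := m + 1) ?_ (Nat.zero_le _)
  rw [succ_mul_catalan_eq_centralBinom]
  exact Nat.centralBinom_pos m

theorem expectedGamma_succ (m : ℕ) :
    expectedGamma (m + 1) = (∑ t ∈ treesOfNumNodesEq m, (gamma t : ℝ)) / catalan m := by
  rw [expectedGamma, treesOfSize, treesOfNumNodesEq_card_eq_catalan]

theorem sum_gamma_le (k m : ℕ) :
    ∑ t ∈ treesOfNumNodesEq m, gamma t ≤
      k * catalan m + ∑ j ∈ Ioc k (m + 1), countGammaGe j m := by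
  have h : ∑ j ∈ Ioc k (m + 1), countGammaGe j m =
      ∑ t ∈ treesOfNumNodesEq m, #{j ∈ Ioc k (m + 1) | j ≤ gamma t} := by
    simp_rw [countGammaGe, card_filter]
    exact sum_comm
  rw [h, mul_comm, ← treesOfNumNodesEq_card_eq_catalan, ← smul_eq_mul, ← sum_const,
    ← sum_add_distrib]
  refine sum_le_sum fun t ht => ?_
  rw [mem_treesOfNumNodesEq] at ht
  have ht' := gamma_le_numLeaves t
  rw [numLeaves_eq_numNodes_succ, ht] at ht'
  have : ({j ∈ Ioc k (m + 1) | j ≤ gamma t} : Finset ℕ) = Ioc k (gamma t) := by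
    ext j
    simp only [mem_filter, mem_Ioc]
    omega
  rw [this, Nat.card_Ioc]
  omega

theorem sum_Ioc_div_two_pow_le (k N : ℕ) :
    ∑ j ∈ Ioc k N, (j : ℝ) / 2 ^ j ≤ (k + 2) / 2 ^ k := by
  rcases le_total N k with h | h
  · rw [Ioc_eq_empty_of_le h, sum_empty]; positivity
  have : ∑ j ∈ Ioc k N, (j : ℝ) / 2 ^ j = (k + 2) / 2 ^ k - (N + 2) / 2 ^ N := by
    induction N, h using Nat.le_induction with
    | base => simp
    | succ N hN ih =>
      rw [sum_Ioc_succ_top hN, ih, pow_succ]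
      push_cast
      field_simp
      ring
  rw [this]
  have : (0 : ℝ) ≤ (N + 2) / 2 ^ N := by positivity
  linarith

theorem expectedGamma_le {k : ℕ} (hk : 1 ≤ k) (m : ℕ) :
    expectedGamma (m + 1) ≤ k + (m + 1) * ((k + 2) / 2 ^ k) := by
  have hc : (0 : ℝ) < catalan m := by exact_mod_cast catalan_pos m
  rw [expectedGamma_succ, div_le_iff₀ hc]
  have h1 : ∑ t ∈ treesOfNumNodesEq m, (gamma t : ℝ) ≤
      k * catalan m + ∑ j ∈ Ioc k (m + 1), (countGammaGe j m : ℝ) := by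
    exact_mod_cast sum_gamma_le k m
  have h2 : ∑ j ∈ Ioc k (m + 1), (countGammaGe j m : ℝ) ≤
      ∑ j ∈ Ioc k (m + 1), (m + 1) * catalan m * ((j : ℝ) / 2 ^ j) := by
    refine sum_le_sum fun j hj => ?_
    rw [mem_Ioc] at hj
    have h : (2 : ℝ) ^ j * countGammaGe j m ≤ (m + 1) * j * catalan m := by
      exact_mod_cast two_pow_mul_countGammaGe_le (k := j) (by omega) m
    rw [← mul_div_assoc, le_div_iff₀ (by positivity)]
    linarith
  rw [← mul_sum] at h2
  have h3 := mul_le_mul_of_nonneg_left (sum_Ioc_div_two_pow_le k (m + 1))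
    (show (0 : ℝ) ≤ (m + 1) * catalan m by positivity)
  linarith

theorem mul_catalan_le_sum_gamma_add (k m : ℕ) :
    k * catalan m ≤ ∑ t ∈ treesOfNumNodesEq m, gamma t + k * countGammaLt k m := by
  rw [countGammaLt, card_filter, mul_sum, ← sum_add_distrib, mul_comm,
    ← treesOfNumNodesEq_card_eq_catalan, ← smul_eq_mul, ← sum_const]
  refine sum_le_sum fun t _ => ?_
  split_ifs <;> omega

theorem le_expectedGamma {k m L : ℕ} (hk : 5 ≤ k) (h1 : 2 ^ k * (3 * (L + 1)) ≤ m + 1)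
    (h2 : m + 1 ≤ 2 ^ (L + 1)) : (k : ℝ) - 4 ≤ expectedGamma (m + 1) := by
  have hc : (0 : ℝ) < catalan m := by exact_mod_cast catalan_pos m
  have hm : (0 : ℝ) < (m : ℝ) + 1 := by positivity
  have hkm : (k : ℝ) ≤ m + 1 := by
    have : k < 2 ^ k := Nat.lt_two_pow_self
    have : k ≤ m + 1 := by nlinarith
    exact_mod_cast this
  -- Two of the three powers absorb the polynomial loss in `countGammaLt_le`; the third leaves a
  -- proportion of at most `4 / (m + 1)`, which costs at most `4` in the mean since `k ≤ m + 1`.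
  have hcube : ((m : ℝ) + 1) ^ 3 ≤ (1 + 1 / 2 ^ k : ℝ) ^ (m + 1) := by
    have hb : (2 : ℝ) ≤ (1 + 1 / 2 ^ k : ℝ) ^ (2 ^ k) := by
      have := one_add_mul_le_pow (a := (1 / 2 ^ k : ℝ))
        (le_trans (by norm_num) (show (0 : ℝ) ≤ 1 / 2 ^ k by positivity)) (2 ^ k)
      refine le_trans (le_of_eq ?_) this
      push_cast
      field_simp
      norm_num
    calc ((m : ℝ) + 1) ^ 3 ≤ (2 ^ (L + 1)) ^ 3 := by gcongr; exact_mod_cast h2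
      _ = 2 ^ (3 * (L + 1)) := by rw [← pow_mul]; congr 1; ring
      _ ≤ ((1 + 1 / 2 ^ k : ℝ) ^ (2 ^ k)) ^ (3 * (L + 1)) := by gcongr
      _ = (1 + 1 / 2 ^ k : ℝ) ^ (2 ^ k * (3 * (L + 1))) := by rw [← pow_mul]
      _ ≤ _ := pow_le_pow_right₀ (le_add_of_nonneg_right (by positivity)) h1
  have hlt : (m + 1) * (countGammaLt k m : ℝ) ≤ 4 * catalan m := by
    have h := countGammaLt_le hk m
    have h' : (countGammaLt k m : ℝ) * ((m : ℝ) + 1) ^ 3 ≤ 4 * (m + 1) ^ 2 * catalan m :=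
      le_trans (by gcongr) h
    refine le_of_mul_le_mul_left ?_ (show (0 : ℝ) < ((m : ℝ) + 1) ^ 2 by positivity)
    linarith
  have hsum : (k : ℝ) * catalan m ≤
      ∑ t ∈ treesOfNumNodesEq m, (gamma t : ℝ) + k * countGammaLt k m := by
    exact_mod_cast mul_catalan_le_sum_gamma_add k m
  have hk' : (k : ℝ) * countGammaLt k m ≤ (m + 1) * countGammaLt k m := by gcongr
  rw [expectedGamma_succ, le_div_iff₀ hc]
  linarith

theorem expectedGamma_nonneg (n : ℕ) : 0 ≤ expectedGamma n :=
  div_nonneg (sum_nonneg fun _ _ => Nat.cast_nonneg _) (Nat.cast_nonneg _)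

theorem abs_expectedGamma_sub_logb_le {n : ℕ} (hn : 1 ≤ n) :
    |expectedGamma n - Real.logb 2 n| ≤ 2 * Real.logb 2 (3 * (Real.logb 2 n + 1)) + 7 := by
  obtain ⟨m, rfl⟩ := Nat.exists_eq_add_of_le' hn
  set L := Nat.log 2 (m + 1) with hL
  -- `J` is the `log log` margin: the cutoffs are `L + 1 + J` from above and `L - J` from below.
  set J := Nat.log 2 (3 * (L + 1)) + 1 with hJ
  set x := Real.logb 2 ((m + 1 : ℕ) : ℝ) with hx
  have hL1 : 2 ^ L ≤ m + 1 := Nat.pow_log_le_self 2 (by omega)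
  have hL2 : m + 1 < 2 ^ (L + 1) := Nat.lt_pow_succ_log_self (by norm_num) _
  have hJ1 : 3 * (L + 1) < 2 ^ J := Nat.lt_pow_succ_log_self (by norm_num) _
  have hx1 : (L : ℝ) ≤ x := Real.natLog_le_logb _ _
  have hx2 : x ≤ L + 1 := by
    rw [hx, Real.logb_le_iff_le_rpow (by norm_num) (by positivity)]
    exact_mod_cast hL2.le
  have hJ2 : (J : ℝ) ≤ Real.logb 2 (3 * (x + 1)) + 1 := by
    have h := Real.natLog_le_logb (3 * (L + 1)) 2
    have h' : Real.logb 2 ((3 * (L + 1) : ℕ) : ℝ) ≤ Real.logb 2 (3 * (x + 1)) := by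
      refine Real.logb_le_logb_of_le (by norm_num) (by positivity) ?_
      push_cast
      linarith
    rw [hJ]
    push_cast at h h' ⊢
    linarith
  have hJ0 : (0 : ℝ) ≤ J := Nat.cast_nonneg _
  have hupper : expectedGamma (m + 1) ≤ L + 2 + 2 * J := by
    have h := expectedGamma_le (k := L + 1 + J) (by omega) m
    have h2 : ((m : ℝ) + 1) * (((L + 1 + J : ℕ) + 2) / 2 ^ (L + 1 + J)) ≤ 1 + J := by
      rw [← mul_div_assoc, div_le_iff₀ (by positivity), pow_add]
      have ha : (m : ℝ) + 1 ≤ 2 ^ (L + 1) := by exact_mod_cast hL2.le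
      have hb : 3 * ((L : ℝ) + 1) ≤ 2 ^ J := by exact_mod_cast hJ1.le
      have hc : ((L + 1 + J : ℕ) : ℝ) + 2 ≤ (1 + J) * 2 ^ J := by
        refine le_trans ?_ (mul_le_mul_of_nonneg_left hb (by positivity))
        have : (0 : ℝ) ≤ J * L := by positivity
        push_cast
        nlinarith [Nat.cast_nonneg (α := ℝ) L]
      calc ((m : ℝ) + 1) * ((L + 1 + J : ℕ) + 2) ≤ 2 ^ (L + 1) * ((1 + J) * 2 ^ J) := by
            gcongr
        _ = _ := by ring
    push_cast at h h2 ⊢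
    linarith
  have hlower : (L : ℝ) - J - 4 ≤ expectedGamma (m + 1) := by
    rcases le_or_gt (L : ℝ) (J + 4) with h | h
    · linarith [expectedGamma_nonneg (m + 1)]
    have hLJ : J + 4 < L := by exact_mod_cast h
    have := le_expectedGamma (k := L - J) (m := m) (L := L) (by omega) ?_ hL2.le
    · rw [Nat.cast_sub (by omega)] at this
      exact this
    · calc 2 ^ (L - J) * (3 * (L + 1)) ≤ 2 ^ (L - J) * 2 ^ J := by gcongr
        _ = 2 ^ L := by rw [← pow_add]; congr 1; omega
        _ ≤ m + 1 := hL1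
  rw [abs_le]
  constructor <;> linarith

theorem isLittleO_logb_affine :
    (fun x : ℝ => 2 * Real.logb 2 (3 * (x + 1)) + 7) =o[atTop] (fun x : ℝ => x) := by
  have hlim : Tendsto (fun x : ℝ => 3 * (x + 1)) atTop atTop :=
    (tendsto_atTop_add_const_right _ _ tendsto_id).const_mul_atTop (by norm_num)
  have hbig : (fun x : ℝ => 3 * (x + 1)) =O[atTop] (fun x : ℝ => x) :=
    ((isBigO_refl _ _).add (isLittleO_const_id_atTop (1 : ℝ)).isBigO).const_mul_left 3
  have hlog : (fun x : ℝ => Real.logb 2 (3 * (x + 1))) =o[atTop] (fun x : ℝ => 3 * (x + 1)) :=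
    (Real.isLittleO_logb_id_atTop (b := 2)).comp_tendsto hlim
  exact ((hlog.trans_isBigO hbig).const_mul_left 2).add (isLittleO_const_id_atTop (7 : ℝ))

end CaterpillarTrees

theorem mainTheorem1 :
    Asymptotics.IsEquivalent Filter.atTop CaterpillarTrees.expectedGamma
      (fun n : ℕ => Real.logb 2 (n : ℝ)) := by
  have hlim : Filter.Tendsto (fun n : ℕ => Real.logb 2 (n : ℝ)) Filter.atTop Filter.atTop :=
    (Real.tendsto_logb_atTop (by norm_num)).comp tendsto_natCast_atTop_atTop
  refine Asymptotics.IsBigO.trans_isLittleO (Asymptotics.IsBigO.of_bound 1 ?_)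
    (CaterpillarTrees.isLittleO_logb_affine.comp_tendsto hlim)
  filter_upwards [Filter.eventually_ge_atTop 1] with n hn
  rw [one_mul, Pi.sub_apply, Real.norm_eq_abs, Real.norm_eq_abs]
  exact (CaterpillarTrees.abs_expectedGamma_sub_logb_le hn).trans (le_abs_self _)
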